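/- All graphs are finite and simple. A graph $G$ is perfect if $\chi(H)=\omega(H)$ for every induced subgraph $H$ of $G$. An even pair of $G$ is a pair of distinct non-adjacent vertices such that every induced path between them has even length; contracting a pair $\{x,y\}$ means removing $x$ and $y$ and adding a new vertex adjacent to every remaining neighbour of $x$ or $y$. A graph is even-contractile if some finite (possibly empty) sequence of contractions of even pairs turns it into a complete graph, and perfectly contractile if each of its induced subgraphs is even-contractile. A hole is an induced cycle of length at least $5$ (odd if its length is odd), and an antihole is the complement of a cycle of length at least $5$ occurring as an induced subgraph. An odd prism is a graph formed by two disjoint triangles $a_1a_2a_3$, $b_1b_2b_3$ and three pairwise disjoint paths of odd length, the $i$-th joining $a_i$ to $b_i$, with no further edges. For a field $K$ and a graph $G$ on $\{1,\dots,n\}$ with stable sets $S_1,\dots,S_m$ (including $\emptyset$), the stable set ring is $K[G]=K\bigl[\bigl(\prod_{i\in S_j}t_i\bigr)s : 1\le j\le m\bigr]\subset K[t_1,\dots,t_n,s]$, and $I_G$ is the kernel of the $K$-algebra map $K[x_1,\dots,x_m]\to K[G]$, $x_j\mapsto\bigl(\prod_{i\in S_j}t_i\bigr)s$. The ring $K[G]$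 is called quadratic if $I_G$ is generated by a (possibly empty) set of quadratic binomials $x_ax_b-x_cx_d$. **Theorem 1.4.** Suppose that the Everett–Reed conjecture is true, that is: a graph is perfectly contractile if and only if it contains no odd holes, no antiholes and no odd prisms as induced subgraphs. Then the Ohsugi–Shibata–Tsuchiya conjecture is true, that is: for every field $K$ and every perfect graph $G$, the following conditions are equivalent: 1. $G$ is perfectly contractile; 2. $G$ contains no odd holes, no antiholes and no odd prisms as induced subgraphs; 3. the stable set ring $K[G]$ is quadratic. -/

import Mathlib

universe u v

namespace StableSetRing

open SimpleGraph

/-! ### Perfect graphs -/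

/-- `G` is perfect: `χ(H) = ω(H)` for every induced subgraph `H`. -/
def IsPerfect {V : Type u} (G : SimpleGraph V) : Prop :=
  ∀ s : Set V, (G.induce s).chromaticNumber = ((G.induce s).cliqueNum : ℕ∞)

/-! ### Even pairs, contraction, perfectly contractile graphs -/

/-- `{x, y}` is an even pair of `G`: `x` and `y` are distinct non-adjacent vertices, and every
induced path between them has even length. -/
def IsEvenPair {V : Type u} (G : SimpleGraph V) (x y : V) : Prop :=
  x ≠ y ∧ ¬ G.Adj x y ∧
    ∀ p : G.Walk x y, p.IsPath → p.IsChordless → Even p.length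

/-- Adjacency after contracting `{x, y}`; `none` is the new vertex. -/
def contractAdj {V : Type u} (G : SimpleGraph V) (x y : V) :
    Option {v : V // v ≠ x ∧ v ≠ y} → Option {v : V // v ≠ x ∧ v ≠ y} → Prop
  | none, none => False
  | none, some w => G.Adj x w.1 ∨ G.Adj y w.1
  | some w, none => G.Adj x w.1 ∨ G.Adj y w.1
  | some w, some w' => G.Adj w.1 w'.1

/-- The graph obtained from `G` by removing `x` and `y` and adding a new vertex (`none`) adjacent
to every remaining vertex that is a neighbour of `x` or of `y`. -/
def contractPair {V : Type u} (G : SimpleGraph V) (x y : V) :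
    SimpleGraph (Option {v : V // v ≠ x ∧ v ≠ y}) where
  Adj := contractAdj G x y
  symm := ⟨by
    rintro (_ | a) (_ | b) h
    · exact h
    · exact h
    · exact h
    · exact G.symm.symm _ _ h⟩
  loopless := ⟨by
    rintro (_ | a) h
    · exact h
    · exact G.loopless.irrefl _ h⟩

/-- `G` is even-contractile: a complete graph can be reached from `G` by a finite (possibly empty)
sequence of contractions of even pairs. -/
inductive IsEvenContractile : {V : Type u} → SimpleGraph V → Prop
  | complete {V : Type u} : IsEvenContractile (⊤ : SimpleGraph V)
  | contract {V : Type u} (G : SimpleGraph V) (x y : V) (hxy : IsEvenPair G x y)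
      (h : IsEvenContractile (contractPair G x y)) : IsEvenContractile G

/-- `G` is perfectly contractile: every induced subgraph of `G` is even-contractile. -/
def IsPerfectlyContractile {V : Type u} (G : SimpleGraph V) : Prop :=
  ∀ s : Set V, IsEvenContractile (G.induce s)

/-! ### Odd holes, antiholes, odd prisms -/

/-- Adjacency in the prism whose three paths have lengths `l 0`, `l 1`, `l 2`: the vertex `⟨i, j⟩`
is the `j`-th vertex of the `i`-th path. -/
def prismAdj (l : Fin 3 → ℕ) (a b : Σ i : Fin 3, Fin (l i + 1)) : Prop :=
  (a.1 = b.1 ∧ (a.2.val + 1 = b.2.val ∨ b.2.val + 1 = a.2.val)) ∨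
  (a.1 ≠ b.1 ∧ ((a.2.val = 0 ∧ b.2.val = 0) ∨ (a.2.val = l a.1 ∧ b.2.val = l b.1)))

/-- The prism with path lengths `l 0`, `l 1`, `l 2`: three pairwise disjoint paths, whose first
vertices form a triangle and whose last vertices form a triangle, and no further edges. -/
def prismGraph (l : Fin 3 → ℕ) : SimpleGraph (Σ i : Fin 3, Fin (l i + 1)) where
  Adj := prismAdj l
  symm := ⟨by
    intro a b h
    unfold prismAdj at *
    grind⟩
  loopless := ⟨by
    intro a h
    unfold prismAdj at h
    grind⟩

/-- `G` has an induced odd cycle of length at least `5`. -/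
def HasOddHole {V : Type u} (G : SimpleGraph V) : Prop :=
  ∃ n : ℕ, 5 ≤ n ∧ Odd n ∧ (cycleGraph n).IsIndContained G

/-- `G` has an induced subgraph that is the complement of a cycle of length at least `5`. -/
def HasAntihole {V : Type u} (G : SimpleGraph V) : Prop :=
  ∃ n : ℕ, 5 ≤ n ∧ ((cycleGraph n)ᶜ).IsIndContained G

/-- `G` has an induced prism whose three paths all have odd length. -/
def HasOddPrism {V : Type u} (G : SimpleGraph V) : Prop :=
  ∃ l : Fin 3 → ℕ, (∀ i, Odd (l i)) ∧ (prismGraph l).IsIndContained G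

/-- `G` contains no odd holes, no antiholes and no odd prisms as induced subgraphs. -/
def IsForbiddenFree {V : Type u} (G : SimpleGraph V) : Prop :=
  ¬ HasOddHole G ∧ ¬ HasAntihole G ∧ ¬ HasOddPrism G

/-! ### The stable set ring and the stable set ideal -/

/-- The stable sets of `G` (including the empty set). -/
abbrev StableSet {V : Type u} (G : SimpleGraph V) : Type u :=
  {S : Finset V // G.IsIndepSet (S : Set V)}

/-- The monomial `t^ρ(S) s` in `K[t, s]`; the variable `t_i` is `X (some i)` and the variable `s`
is `X none`. -/
noncomputable def stableMonomial (K : Type v) [Field K] {V : Type u} (G : SimpleGraph V)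
    (S : StableSet G) : MvPolynomial (Option V) K :=
  (∏ i ∈ S.1, MvPolynomial.X (some i)) * MvPolynomial.X none

/-- The stable set ring `K[G] ⊆ K[t, s]`. -/
noncomputable def stableSetRing (K : Type v) [Field K] {V : Type u} (G : SimpleGraph V) :
    Subalgebra K (MvPolynomial (Option V) K) :=
  Algebra.adjoin K (Set.range (stableMonomial K G))

/-- The homomorphism `π : K[x] → K[G]` that sends the variable `x_S` to `t^ρ(S) s`. -/
noncomputable def stableSetMap (K : Type v) [Field K] {V : Type u} (G : SimpleGraph V) :
    MvPolynomial (StableSet G) K →ₐ[K] stableSetRing K G :=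
  MvPolynomial.aeval fun S : StableSet G =>
    (⟨stableMonomial K G S, Algebra.subset_adjoin (Set.mem_range_self S)⟩ : stableSetRing K G)

/-- The stable set ideal `I_G`, the kernel of `π`. -/
noncomputable def stableSetIdeal (K : Type v) [Field K] {V : Type u} (G : SimpleGraph V) :
    Ideal (MvPolynomial (StableSet G) K) :=
  RingHom.ker (stableSetMap K G)

/-- `f` is a quadratic binomial, that is, a difference of two monomials of degree two. -/
def IsQuadraticBinomial {K : Type v} [Field K] {σ : Type u} (f : MvPolynomial σ K) : Prop :=
  ∃ a b c d : σ,
    f = MvPolynomial.X a * MvPolynomial.X b - MvPolynomial.X c * MvPolynomial.X d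

/-- `K[G]` is quadratic: `I_G` is generated by a (possibly empty) set of quadratic binomials. -/
def IsQuadratic (K : Type v) [Field K] {V : Type u} (G : SimpleGraph V) : Prop :=
  ∃ B : Set (MvPolynomial (StableSet G) K),
    (∀ f ∈ B, IsQuadraticBinomial f) ∧ Ideal.span B = stableSetIdeal K G

/-! ### The two conjectures -/

/-- The Everett–Reed conjecture: a finite graph is perfectly contractile if and only if it contains
no odd holes, no antiholes and no odd prisms as induced subgraphs. -/
def EverettReedConjecture : Prop :=
  ∀ (V : Type u) [Finite V] (G : SimpleGraph V),
    IsPerfectlyContractile G ↔ IsForbiddenFree G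

/-- The Ohsugi–Shibata–Tsuchiya conjecture over the field `K`: for a finite perfect graph `G`,
perfect contractility, the absence of odd holes, antiholes and odd prisms, and quadraticity of
`K[G]` are equivalent. -/
def OhsugiShibataTsuchiyaConjecture (K : Type v) [Field K] : Prop :=
  ∀ (V : Type u) [Finite V] (G : SimpleGraph V), IsPerfect G →
    List.TFAE [IsPerfectlyContractile G, IsForbiddenFree G, IsQuadratic K G]

end StableSetRing

/-! The equivalence of 1 and 2 is the hypothesis, so the content is that 2 and 3 are equivalent.

From 2 to 3: a product of `k` variables whose image has `t`-exponents `a` is a list of `k` stable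
sets covering each `v` exactly `a v` times, that is, a `k`-coloring of the blow-up of `G` by cliques
of size `a v`. Two monomials with the same image color the same blow-up, and a Kempe change is a
move by a quadratic binomial. So `K[G]` is quadratic once all colorings of all blow-ups are Kempe
equivalent (`isQuadratic_of_kempeEquiv`). The forbidden graphs have no adjacent twins, so blow-ups
remain free of them and Everett–Reed makes the blow-ups even-contractile. Kempe equivalence then
follows by induction along contractions (`IsEvenContractile.kempeEquiv`).

From 3 to 2: perfection excludes odd holes and odd antiholes. Even antiholes and odd prisms have a
fiber with a squarefree monomial that no quadratic binomial can move, although the fiber has another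
element. This obstruction passes to any graph containing them (`HasRigidFiber.of_isIndContained`,
`HasRigidFiber.not_isQuadratic`). -/

namespace SimpleGraph

variable {V : Type u} {G : SimpleGraph V}

/-- A chord in `G` would be an edge of `H` by `hind`, hence a shortcut of a shortest walk. It is
used with `H` spanned by two color classes, to produce an induced path of `G`. -/
theorem Walk.isPath_mapLe_isChordless_of_length_eq_dist {H : SimpleGraph V} (hle : H ≤ G)
    {x y : V} (p : H.Walk x y) (hp : p.length = H.dist x y)
    (hind : ∀ u ∈ p.support, ∀ v ∈ p.support, G.Adj u v → H.Adj u v) :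
    (p.mapLe hle).IsPath ∧ (p.mapLe hle).IsChordless := by
  refine ⟨(Walk.isPath_mapLe hle).2 (p.isPath_of_length_eq_dist hp), ?_⟩
  have key : ∀ i j, i < j → j ≤ p.length → H.Adj (p.getVert i) (p.getVert j) →
      s(p.getVert i, p.getVert j) ∈ p.edges := by
    intro i j hij hj hadj
    have hlen := H.dist_le ((p.take i).append (Walk.cons hadj (p.drop j)))
    simp only [Walk.length_append, Walk.length_cons, Walk.take_length, Walk.drop_length] at hlen
    obtain rfl : j = i + 1 := by omega
    exact p.mk_mem_edges_iff_exists.2 ⟨i, by omega, rfl⟩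
  rw [Walk.isChordless_iff_forall_mem_edges]
  intro a b ha hb hab
  rw [Walk.support_mapLe_eq_support] at ha hb
  rw [Walk.edges_mapLe_eq_edges]
  have hab' := hind a ha b hb hab
  obtain ⟨i, rfl, hi⟩ := Walk.mem_support_iff_exists_getVert.1 ha
  obtain ⟨j, rfl, hj⟩ := Walk.mem_support_iff_exists_getVert.1 hb
  rcases lt_trichotomy i j with h | rfl | h
  · exact key i j h hj hab'
  · exact (hab'.ne rfl).elim
  · rw [Sym2.eq_swap]
    exact key j i h hi hab'.symm

end SimpleGraph

namespace StableSetRing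

open SimpleGraph

/-! ### Kempe equivalence and contraction of even pairs -/

section Kempe

variable {V : Type u} {G : SimpleGraph V} {k : ℕ}

/-- Two colorings that differ by Kempe changes on one pair of colors: they agree outside the
vertices that have one of two fixed colors. -/
def KempeStep (c d : G.Coloring (Fin k)) : Prop :=
  ∃ α β : Fin k, ∀ x, c x = d x ∨ ((c x = α ∨ c x = β) ∧ (d x = α ∨ d x = β))

theorem KempeStep.symm {c d : G.Coloring (Fin k)} (h : KempeStep c d) : KempeStep d c := by
  obtain ⟨α, β, h⟩ := h
  exact ⟨α, β, fun x => (h x).imp Eq.symm And.symm⟩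

/-- Kempe equivalence of colorings. -/
def KempeEquiv : G.Coloring (Fin k) → G.Coloring (Fin k) → Prop :=
  Relation.ReflTransGen KempeStep

theorem KempeEquiv.symm {c d : G.Coloring (Fin k)} (h : KempeEquiv c d) : KempeEquiv d c :=
  by
  induction h with
  | refl => exact Relation.ReflTransGen.refl
  | tail _ h ih => exact (Relation.ReflTransGen.single h.symm).trans ih

theorem KempeEquiv.trans {c d e : G.Coloring (Fin k)} (h : KempeEquiv c d)
    (h' : KempeEquiv d e) : KempeEquiv c e :=
  Relation.ReflTransGen.trans h h'

theorem KempeEquiv.comp {W : Type*} {H : SimpleGraph W} (f : G →g H)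
    {c d : H.Coloring (Fin k)} (h : KempeEquiv c d) :
    KempeEquiv (G := G) (c.comp f) (d.comp f) := by
  induction h with
  | refl => exact Relation.ReflTransGen.refl
  | tail _ h ih =>
    obtain ⟨α, β, hab⟩ := h
    exact ih.tail ⟨α, β, fun x => hab (f x)⟩

/-- The coloring obtained by renaming the colors. -/
def permColoring (σ : Equiv.Perm (Fin k)) (c : G.Coloring (Fin k)) : G.Coloring (Fin k) :=
  Coloring.mk (fun x => σ (c x)) fun h => σ.injective.ne (c.valid h)

/-- A transposition of colors is a single Kempe step, and transpositions generate all permutations.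
-/
theorem kempeEquiv_permColoring (σ : Equiv.Perm (Fin k)) (c : G.Coloring (Fin k)) :
    KempeEquiv c (permColoring σ c) := by
  induction σ using Equiv.Perm.swap_induction_on with
  | one => exact Relation.ReflTransGen.refl
  | swap_mul τ α β hαβ ih =>
    refine ih.trans (Relation.ReflTransGen.single ⟨α, β, fun x => ?_⟩)
    change τ (c x) = Equiv.swap α β (τ (c x)) ∨
      ((τ (c x) = α ∨ τ (c x) = β) ∧
        (Equiv.swap α β (τ (c x)) = α ∨ Equiv.swap α β (τ (c x)) = β))
    by_cases h1 : τ (c x) = α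
    · simp [h1]
    by_cases h2 : τ (c x) = β
    · simp [h2]
    simp [Equiv.swap_apply_of_ne_of_ne h1 h2]

/-- Colorings of a complete graph are injective, so the matching of used colors extends to a
permutation of all colors. -/
theorem kempeEquiv_of_complete (c d : (⊤ : SimpleGraph V).Coloring (Fin k)) : KempeEquiv c d := by
  classical
  have hc : Function.Injective c := fun x y h => by
    by_contra hne
    exact c.valid (by simpa using hne) h
  have hd : Function.Injective d := fun x y h => by
    by_contra hne
    exact d.valid (by simpa using hne) h
  let e : {i // i ∈ Set.range c} ≃ {i // i ∈ Set.range d} :=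
    (Equiv.ofInjective c hc).symm.trans (Equiv.ofInjective d hd)
  have hcd : permColoring e.extendSubtype c = d := by
    ext1 x
    have := e.extendSubtype_apply_of_mem (c x) ⟨x, rfl⟩
    refine this.trans ?_
    have hx : (Equiv.ofInjective c hc).symm ⟨c x, x, rfl⟩ = x :=
      Equiv.ofInjective_symm_apply hc x
    simp [e, hx]
  rw [← hcd]
  exact kempeEquiv_permColoring _ c

/-- A Kempe change makes the colors of the two vertices of an even pair equal. -/
theorem IsEvenPair.exists_kempeEquiv {x y : V} (hxy : IsEvenPair G x y)
    (c : G.Coloring (Fin k)) : ∃ d : G.Coloring (Fin k), KempeEquiv c d ∧ d x = d y := by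
  classical
  by_cases hne : c x = c y
  · exact ⟨c, Relation.ReflTransGen.refl, hne⟩
  let W : Set V := {v | c v = c x ∨ c v = c y}
  let H : SimpleGraph V :=
    { Adj := fun a b => G.Adj a b ∧ a ∈ W ∧ b ∈ W
      symm := ⟨fun a b h => ⟨h.1.symm, h.2.2, h.2.1⟩⟩
      loopless := ⟨fun a h => h.1.ne rfl⟩ }
  have hle : H ≤ G := fun a b h => h.1
  have hW : ∀ {a}, H.Reachable x a → a ∈ W := by
    intro a hr
    rw [reachable_iff_reflTransGen] at hr
    induction hr with
    | refl => exact Or.inl rfl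
    | tail _ h _ => exact h.2.2
  -- A shortest two-colored path from `x` to `y` would be induced in `G`, hence even. Colors
  -- alternate along it, so its ends would have the same color.
  have hnot : ¬ H.Reachable x y := by
    intro hr
    obtain ⟨p, hp⟩ := hr.exists_walk_length_eq_dist
    obtain ⟨hpath, hch⟩ := Walk.isPath_mapLe_isChordless_of_length_eq_dist hle p hp
      fun a ha b hb hab =>
        ⟨hab, hW (p.takeUntil a ha).reachable, hW (p.takeUntil b hb).reachable⟩
    have heven := hxy.2.2 _ hpath hch
    rw [Walk.length_mapLe] at heven
    let e : H.Coloring Bool := Coloring.mk (fun v => decide (c v = c x)) (by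
      rintro a b ⟨hab, ha, hb⟩ h
      have hv := c.valid hab
      rw [decide_eq_decide] at h
      rcases ha with ha | ha <;> rcases hb with hb | hb <;> grind)
    have := (e.even_length_iff_congr p).1 heven
    have h1 : e x = true := decide_eq_true rfl
    have h2 : e y = true := this.1 h1
    have h3 : c y = c x := of_decide_eq_true h2
    exact hne h3.symm
  -- Swap the two colors on the component of `x` only: `x` takes the color of `y`, which stays
  -- fixed.
  refine ⟨Coloring.mk (fun v => if H.Reachable x v then Equiv.swap (c x) (c y) (c v) else c v)
    ?_, Relation.ReflTransGen.single ⟨c x, c y, fun v => ?_⟩, ?_⟩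
  · have key : ∀ {a b}, G.Adj a b → H.Reachable x a → ¬ H.Reachable x b →
        Equiv.swap (c x) (c y) (c a) ≠ c b := by
      intro a b hab ha hb h
      refine hb (ha.trans (Adj.reachable ⟨hab, hW ha, ?_⟩))
      rcases hW ha with h' | h'
      · rw [h', Equiv.swap_apply_left] at h
        exact Or.inr h.symm
      · rw [h', Equiv.swap_apply_right] at h
        exact Or.inl h.symm
    intro a b hab
    by_cases ha : H.Reachable x a <;> by_cases hb : H.Reachable x b
    · simpa [ha, hb] using c.valid hab
    · simpa [ha, hb] using key hab ha hb
    · simpa [ha, hb] using (key hab.symm hb ha).symm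
    · simpa [ha, hb] using c.valid hab
  · change c v = (if _ then _ else _) ∨ _ ∧ ((if _ then _ else _) = _ ∨ (if _ then _ else _) = _)
    by_cases hv : H.Reachable x v
    · refine Or.inr ⟨hW hv, ?_⟩
      rcases hW hv with h | h <;> simp [hv, h]
    · simp [hv]
  · change (if _ then _ else _) = (if _ then _ else _)
    simp [hnot]

open Classical in
/-- The projection of a graph onto the graph obtained by contracting two vertices. -/
noncomputable def contractProj {x y : V} (hxy : ¬ G.Adj x y) : G →g contractPair G x y where
  toFun v := if h : v ≠ x ∧ v ≠ y then some ⟨v, h⟩ else none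
  map_rel' := by
    intro a b hab
    by_cases ha : a ≠ x ∧ a ≠ y <;> by_cases hb : b ≠ x ∧ b ≠ y
    · simp only [dif_pos ha, dif_pos hb]
      exact hab
    · simp only [dif_pos ha, dif_neg hb]
      change G.Adj x a ∨ G.Adj y a
      have := hab.symm
      grind
    · simp only [dif_neg ha, dif_pos hb]
      change G.Adj x b ∨ G.Adj y b
      grind
    · have := hab.symm
      have := hab.ne
      grind

/-- A coloring that gives `x` and `y` the same color descends to the contraction. -/
theorem exists_comp_contractProj {x y : V} (hxy : ¬ G.Adj x y) (c : G.Coloring (Fin k))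
    (hc : c x = c y) :
    ∃ d : (contractPair G x y).Coloring (Fin k), d.comp (contractProj hxy) = c := by
  classical
  refine ⟨Coloring.mk (fun o => o.elim (c x) fun v => c v.1) ?_, ?_⟩
  · rintro (_ | a) (_ | b) hab
    · exact hab.elim
    · change c x ≠ c b.1
      rcases hab with h | h
      · exact c.valid h
      · rw [hc]; exact c.valid h
    · change c a.1 ≠ c x
      rcases hab with h | h
      · exact (c.valid h).symm
      · rw [hc]; exact (c.valid h).symm
    · exact c.valid (show G.Adj a.1 b.1 from hab)
  · ext1 v
    change Option.elim (if h : v ≠ x ∧ v ≠ y then some (⟨v, h⟩ : {v // v ≠ x ∧ v ≠ y}) else none)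
      (c x) (fun v => c v.1) = c v
    split_ifs with h
    · rfl
    · by_cases hx : v = x
      · rw [hx]; rfl
      · have hy : v = y := by tauto
        rw [hy, ← hc]; rfl

/-- All colorings of an even-contractile graph with a given number of colors are
Kempe equivalent. -/
theorem IsEvenContractile.kempeEquiv {V : Type u} {G : SimpleGraph V} (hG : IsEvenContractile G)
    {k : ℕ} (c d : G.Coloring (Fin k)) : KempeEquiv c d := by
  induction hG with
  | complete => exact kempeEquiv_of_complete c d
  | contract G x y hxy h ih =>
    obtain ⟨c₁, hc, hc₁⟩ := hxy.exists_kempeEquiv c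
    obtain ⟨d₁, hd, hd₁⟩ := hxy.exists_kempeEquiv d
    obtain ⟨c₂, rfl⟩ := exists_comp_contractProj hxy.2.1 c₁ hc₁
    obtain ⟨d₂, rfl⟩ := exists_comp_contractProj hxy.2.1 d₁ hd₁
    exact (hc.trans ((ih c₂ d₂).comp _)).trans hd.symm

end Kempe

end StableSetRing

/-! ### Blow-ups and forbidden induced subgraphs -/

namespace SimpleGraph

theorem cycleGraph_adj_iff_val {n : ℕ} (hn : 3 ≤ n) {u v : Fin n} :
    (cycleGraph n).Adj u v ↔ u.val + 1 = v.val ∨ v.val + 1 = u.val ∨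
      (u.val = 0 ∧ v.val + 1 = n) ∨ (v.val = 0 ∧ u.val + 1 = n) := by
  have hu := u.isLt
  have hv := v.isLt
  rw [cycleGraph_adj']
  rcases lt_trichotomy u v with h | rfl | h
  · have h' : u.val < v.val := h
    rw [Fin.coe_sub_iff_lt.2 h, Fin.coe_sub_iff_le.2 h.le]
    omega
  · rw [Fin.coe_sub_iff_le.2 le_rfl]
    omega
  · have h' : v.val < u.val := h
    rw [Fin.coe_sub_iff_lt.2 h, Fin.coe_sub_iff_le.2 h.le]
    omega

end SimpleGraph

namespace StableSetRing

open SimpleGraph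

/-- A graph is twin-separated if adjacent vertices never have the same closed neighbourhood. -/
def IsTwinSeparated {W : Type*} (H : SimpleGraph W) : Prop :=
  ∀ x y, H.Adj x y → ∃ z, z ≠ x ∧ z ≠ y ∧ ¬ (H.Adj x z ↔ H.Adj y z)

/-- The blow-up of `G` in which every vertex `v` is replaced by a clique of size `a v`. -/
def blowup {V : Type u} (G : SimpleGraph V) (a : V → ℕ) : SimpleGraph (Σ v, Fin (a v)) where
  Adj p q := G.Adj p.1 q.1 ∨ (p.1 = q.1 ∧ p ≠ q)
  symm := ⟨fun _ _ h => h.imp Adj.symm fun h => ⟨h.1.symm, h.2.symm⟩⟩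
  loopless := ⟨fun _ h => h.elim (fun h => h.ne rfl) fun h => h.2 rfl⟩

/-- Two vertices of `H` sent to the same clique would be adjacent twins, so the projection to `G` is
injective on the copy of `H`. -/
theorem IsTwinSeparated.isIndContained_of_blowup {V : Type u} {G : SimpleGraph V} {a : V → ℕ}
    {W : Type*} {H : SimpleGraph W} (hH : IsTwinSeparated H)
    (h : H.IsIndContained (blowup G a)) : H.IsIndContained G := by
  obtain ⟨f⟩ := h
  have hadj : ∀ x y, H.Adj x y ↔ (G.Adj (f x).1 (f y).1 ∨ ((f x).1 = (f y).1 ∧ f x ≠ f y)) :=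
    fun x y => (f.map_rel_iff' (a := x) (b := y)).symm
  have hinj : Function.Injective fun x => (f x).1 := by
    intro x y hxy
    simp only at hxy
    by_contra hne
    obtain ⟨z, hzx, hzy, hz⟩ := hH x y ((hadj x y).2 (Or.inr ⟨hxy, f.injective.ne hne⟩))
    apply hz
    rw [hadj, hadj, hxy]
    simp [f.injective.ne hzx.symm, f.injective.ne hzy.symm]
  refine ⟨⟨⟨fun x => (f x).1, hinj⟩, ?_⟩⟩
  intro x y
  rw [hadj x y]
  refine ⟨Or.inl, ?_⟩
  rintro (h | ⟨h, hne⟩)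
  · exact h
  · exact (hne (congrArg f (hinj h))).elim

/-- Cyclic successor and predecessor, phrased in linear arithmetic so that `omega` settles later
case distinctions. -/
theorem exists_cycleGraph_neighbors {n : ℕ} (hn : 5 ≤ n) (x : Fin n) : ∃ s p : Fin n,
    ((s.val = x.val + 1 ∧ x.val + 1 < n) ∨ (s.val = 0 ∧ x.val + 1 = n)) ∧
    ((x.val = p.val + 1) ∨ (p.val + 1 = n ∧ x.val = 0)) := by
  have hx := x.isLt
  rcases Nat.lt_or_ge (x.val + 1) n with h | h <;> rcases Nat.eq_zero_or_pos x.val with h0 | h0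
  · exact ⟨⟨x.val + 1, h⟩, ⟨n - 1, by omega⟩, by simp; omega, by simp; omega⟩
  · exact ⟨⟨x.val + 1, h⟩, ⟨x.val - 1, by omega⟩, by simp; omega, by simp; omega⟩
  · omega
  · exact ⟨⟨0, by omega⟩, ⟨x.val - 1, by omega⟩, by simp; omega, by simp; omega⟩

theorem isTwinSeparated_cycleGraph {n : ℕ} (hn : 5 ≤ n) : IsTwinSeparated (cycleGraph n) := by
  intro x y hxy
  obtain ⟨s, p, hs, hp⟩ := exists_cycleGraph_neighbors hn x
  have hx := x.isLt
  have hy := y.isLt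
  rw [cycleGraph_adj_iff_val (by omega)] at hxy
  by_cases h : s = y
  · refine ⟨p, ?_, ?_, ?_⟩
    · rw [Ne, Fin.ext_iff]; omega
    · rw [← h, Ne, Fin.ext_iff]; omega
    · rw [← h, cycleGraph_adj_iff_val (by omega), cycleGraph_adj_iff_val (by omega)]
      omega
  · refine ⟨s, ?_, h, ?_⟩
    · rw [Ne, Fin.ext_iff]; omega
    · rw [Fin.ext_iff] at h
      rw [cycleGraph_adj_iff_val (by omega), cycleGraph_adj_iff_val (by omega)]
      omega

/-- The witness is a cycle neighbor of `x` that is not one of `y`; if both neighbors were shared,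
they would close a 4-cycle. -/
theorem isTwinSeparated_compl_cycleGraph {n : ℕ} (hn : 5 ≤ n) :
    IsTwinSeparated (cycleGraph n)ᶜ := by
  intro x y hxy
  obtain ⟨s, p, hs, hp⟩ := exists_cycleGraph_neighbors hn x
  have hx := x.isLt
  have hy := y.isLt
  rw [compl_adj, cycleGraph_adj_iff_val (by omega), Ne, Fin.ext_iff] at hxy
  by_cases h : (cycleGraph n).Adj y s
  · rw [cycleGraph_adj_iff_val (by omega)] at h
    refine ⟨p, ?_, ?_, ?_⟩
    · rw [Ne, Fin.ext_iff]; omega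
    · rw [Ne, Fin.ext_iff]; omega
    · rw [compl_adj, compl_adj, cycleGraph_adj_iff_val (by omega),
        cycleGraph_adj_iff_val (by omega), Ne, Ne, Fin.ext_iff, Fin.ext_iff]
      omega
  · rw [cycleGraph_adj_iff_val (by omega)] at h
    refine ⟨s, ?_, ?_, ?_⟩
    · rw [Ne, Fin.ext_iff]; omega
    · rw [Ne, Fin.ext_iff]; omega
    · rw [compl_adj, compl_adj, cycleGraph_adj_iff_val (by omega),
        cycleGraph_adj_iff_val (by omega), Ne, Ne, Fin.ext_iff, Fin.ext_iff]
      omega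

/-- A path edge is separated by the preceding path vertex, or at the start by another vertex of the
triangle; a triangle edge by the path neighbor of one end. Oddness enters only through positive
lengths. -/
theorem isTwinSeparated_prismGraph {l : Fin 3 → ℕ} (hl : ∀ i, Odd (l i)) :
    IsTwinSeparated (prismGraph l) := by
  have hpos : ∀ i, 0 < l i := fun i => (hl i).pos
  have hpath : ∀ (i : Fin 3) (s t : Fin (l i + 1)), s.val + 1 = t.val →
      ∃ z : Σ i : Fin 3, Fin (l i + 1), z ≠ ⟨i, s⟩ ∧ z ≠ ⟨i, t⟩ ∧
        ¬ (prismAdj l ⟨i, s⟩ z ↔ prismAdj l ⟨i, t⟩ z) := by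
    intro i s t hst
    have ht := t.isLt
    rcases Nat.eq_zero_or_pos s.val with h | h
    · obtain ⟨j, hj⟩ : ∃ j : Fin 3, j ≠ i := exists_ne i
      have := hpos j
      refine ⟨⟨j, 0⟩, ?_, ?_, ?_⟩
      · simp [hj]
      · simp [hj]
      · intro hiff
        rcases hiff.1 (Or.inr ⟨hj.symm, Or.inl ⟨h, rfl⟩⟩) with ⟨h', -⟩ | ⟨-, ⟨h', -⟩ | ⟨-, h'⟩⟩
        · exact hj h'.symm
        · simp only at h'
          omega
        · simp only [Fin.val_zero] at h'
          omega
    · refine ⟨⟨i, ⟨s.val - 1, by omega⟩⟩, ?_, ?_, ?_⟩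
      · simp [Fin.ext_iff]; omega
      · simp [Fin.ext_iff]; omega
      · simp [prismAdj]; omega
  rintro ⟨i, s⟩ ⟨j, t⟩ h
  have hi := hpos i
  have hj := hpos j
  rcases h with ⟨rfl, h | h⟩ | ⟨hne, ⟨hs, ht⟩ | ⟨hs, ht⟩⟩
  · exact hpath i s t h
  · obtain ⟨z, h₁, h₂, h₃⟩ := hpath i t s h
    exact ⟨z, h₂, h₁, fun h => h₃ h.symm⟩
  · simp only at hne hs ht
    refine ⟨⟨i, ⟨1, by omega⟩⟩, ?_, ?_, ?_⟩
    · simp [Fin.ext_iff, hs]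
    · simp [hne]
    · change ¬ (prismAdj l _ _ ↔ prismAdj l _ _)
      simp only [prismAdj, hs, ht, Ne.symm hne]
      simp
      omega
  · simp only at hne hs ht
    refine ⟨⟨i, ⟨l i - 1, by omega⟩⟩, ?_, ?_, ?_⟩
    · simp [Fin.ext_iff, hs]; omega
    · simp [hne]
    · change ¬ (prismAdj l _ _ ↔ prismAdj l _ _)
      simp only [prismAdj, hs, ht, Ne.symm hne]
      simp
      omega

theorem IsForbiddenFree.blowup {V : Type u} {G : SimpleGraph V} (hG : IsForbiddenFree G)
    (a : V → ℕ) : IsForbiddenFree (blowup G a) := by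
  refine ⟨?_, ?_, ?_⟩
  · rintro ⟨n, hn, hodd, h⟩
    exact hG.1 ⟨n, hn, hodd, (isTwinSeparated_cycleGraph hn).isIndContained_of_blowup h⟩
  · rintro ⟨n, hn, h⟩
    exact hG.2.1 ⟨n, hn, (isTwinSeparated_compl_cycleGraph hn).isIndContained_of_blowup h⟩
  · rintro ⟨l, hl, h⟩
    exact hG.2.2 ⟨l, hl, (isTwinSeparated_prismGraph hl).isIndContained_of_blowup h⟩

/-- Under the Everett-Reed conjecture, all colorings of a blow-up of a graph without odd holes,
antiholes and odd prisms are Kempe equivalent. -/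
theorem IsForbiddenFree.kempeEquiv_blowup (hER : EverettReedConjecture.{u}) {V : Type u} [Finite V]
    {G : SimpleGraph V} (hG : IsForbiddenFree G) {a : V → ℕ} {k : ℕ}
    (c d : (StableSetRing.blowup G a).Coloring (Fin k)) : KempeEquiv c d := by
  have h := (hER _ _).2 (hG.blowup a) Set.univ
  let e : (StableSetRing.blowup G a).induce Set.univ ≃g StableSetRing.blowup G a := induceUnivIso _
  exact (h.kempeEquiv (c.comp e.toHom) (d.comp e.toHom)).comp e.symm.toHom

open MvPolynomial

/-! ### Exponent vectors and membership in the stable set ideal -/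

section Weights

variable {V : Type u} {G : SimpleGraph V}

open Classical in
/-- The exponent vector of the monomial of a stable set. -/
noncomputable def weight (S : StableSet G) : Option V →₀ ℕ :=
  ∑ i ∈ S.1, Finsupp.single (some i) 1 + Finsupp.single none 1

@[simp]
theorem weight_none (S : StableSet G) : weight S none = 1 := by
  simp [weight]

open Classical in
@[simp]
theorem weight_some (S : StableSet G) (v : V) : weight S (some v) = if v ∈ S.1 then 1 else 0 := by
  simp [weight, Finsupp.single_apply]

theorem stableMonomial_eq (K : Type v) [Field K] (S : StableSet G) :
    stableMonomial K G S = monomial (weight S) 1 := by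
  simp only [stableMonomial, weight, X, monomial_mul, mul_one, ← monomial_sum_one]

theorem mem_stableSetIdeal_iff (K : Type v) [Field K] (p : MvPolynomial (StableSet G) K) :
    p ∈ stableSetIdeal K G ↔ aeval (stableMonomial K G) p = 0 := by
  have h : ∀ p, ((stableSetMap K G p : stableSetRing K G) : MvPolynomial (Option V) K) =
      aeval (stableMonomial K G) p := by
    intro p
    have : (stableSetRing K G).val.comp (stableSetMap K G) = aeval (stableMonomial K G) := by
      ext1 S
      simp [stableSetMap]
    exact DFunLike.congr_fun this p
  rw [stableSetIdeal, RingHom.mem_ker, ← h, ZeroMemClass.coe_eq_zero]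

theorem aeval_prod_X (K : Type v) [Field K] {ι : Type*} (s : Finset ι) (S : ι → StableSet G) :
    aeval (stableMonomial K G) (∏ i ∈ s, X (S i) : MvPolynomial _ K) = monomial (∑ i ∈ s, weight (S i)) (1 : K) := by
  simp only [map_prod, aeval_X, stableMonomial_eq, ← monomial_sum_one]

theorem aeval_X_mul_X (K : Type v) [Field K] (A B : StableSet G) :
    aeval (stableMonomial K G) (X A * X B : MvPolynomial _ K) =
      monomial (weight A + weight B) (1 : K) := by
  simp only [map_mul, aeval_X, stableMonomial_eq, monomial_mul, mul_one]

theorem X_mul_X_sub_mem_iff (K : Type v) [Field K] (A B C D : StableSet G) :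
    X A * X B - X C * X D ∈ stableSetIdeal K G ↔ weight A + weight B = weight C + weight D := by
  rw [mem_stableSetIdeal_iff, map_sub, aeval_X_mul_X, aeval_X_mul_X, sub_eq_zero,
    (monomial_left_injective one_ne_zero).eq_iff]

theorem sum_weight_none {ι : Type*} (s : Finset ι) (S : ι → StableSet G) :
    (∑ i ∈ s, weight (S i)) none = s.card := by
  simp [Finsupp.finsetSum_apply]

open Classical in
theorem sum_weight_some {ι : Type*} (s : Finset ι) (S : ι → StableSet G) (v : V) :
    (∑ i ∈ s, weight (S i)) (some v) = (s.filter fun i => v ∈ (S i).1).card := by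
  rw [Finsupp.finsetSum_apply, Finset.card_filter]
  exact Finset.sum_congr rfl fun i _ => weight_some _ _

end Weights

theorem exists_monomial_eq_prod {σ : Type*} (K : Type v) [Field K] (m : σ →₀ ℕ) :
    ∃ (k : ℕ) (S : Fin k → σ), monomial m (1 : K) = ∏ i, X (S i) := by
  induction m using Finsupp.induction_linear with
  | zero => exact ⟨0, Fin.elim0, by simp⟩
  | add f g hf hg =>
    obtain ⟨k, S, hS⟩ := hf
    obtain ⟨l, T, hT⟩ := hg
    refine ⟨k + l, Fin.append S T, ?_⟩
    rw [Fin.prod_univ_add]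
    simp only [Fin.append_left, Fin.append_right, ← hS, ← hT, monomial_mul, mul_one]
  | single a n => exact ⟨n, fun _ => a, by simp [X_pow_eq_monomial]⟩

/-! ### Colorings of blow-ups as lists of stable sets -/

section ColorClasses

variable {V : Type u} {G : SimpleGraph V} {a : V → ℕ} {k : ℕ}

theorem injective_coloring_fiber (c : (blowup G a).Coloring (Fin k)) (v : V) :
    Function.Injective fun j => c ⟨v, j⟩ := by
  intro j j' h
  by_contra hne
  exact c.valid (show (blowup G a).Adj ⟨v, j⟩ ⟨v, j'⟩ from Or.inr ⟨rfl, by simpa using hne⟩) h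

variable [Finite V]

/-- The vertices of `G` having a copy of a given color in a coloring of the blow-up. -/
noncomputable def colorClass (c : (blowup G a).Coloring (Fin k)) (i : Fin k) : StableSet G :=
  ⟨(Set.toFinite {v | ∃ j, c ⟨v, j⟩ = i}).toFinset, by
    intro v hv w hw _ hvw
    simp only [Set.Finite.coe_toFinset, Set.mem_ofPred_eq] at hv hw
    obtain ⟨j, hj⟩ := hv
    obtain ⟨j', hj'⟩ := hw
    exact c.valid (show (blowup G a).Adj ⟨v, j⟩ ⟨w, j'⟩ from Or.inl hvw) (hj.trans hj'.symm)⟩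

theorem mem_colorClass {c : (blowup G a).Coloring (Fin k)} {i : Fin k} {v : V} :
    v ∈ (colorClass c i).1 ↔ ∃ j, c ⟨v, j⟩ = i := by
  simp [colorClass]

theorem weight_colorClass_some (c : (blowup G a).Coloring (Fin k)) (i : Fin k) (v : V) :
    weight (colorClass c i) (some v) = (Finset.univ.filter fun j => c ⟨v, j⟩ = i).card := by
  classical
  rw [weight_some]
  have hle : (Finset.univ.filter fun j => c ⟨v, j⟩ = i).card ≤ 1 := by
    rw [Finset.card_le_one]
    intro j hj j' hj'
    simp only [Finset.mem_filter, Finset.mem_univ, true_and] at hj hj'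
    exact injective_coloring_fiber c v (hj.trans hj'.symm)
  split_ifs with h
  · obtain ⟨j, hj⟩ := mem_colorClass.1 h
    have : 0 < (Finset.univ.filter fun j => c ⟨v, j⟩ = i).card :=
      Finset.card_pos.2 ⟨j, by simpa using hj⟩
    omega
  · rw [mem_colorClass] at h
    push Not at h
    symm
    rw [Finset.card_eq_zero, Finset.filter_eq_empty_iff]
    exact fun j _ => h j

/-- The exponent at `v` counts the copies of `v` colored `α` or `β`, and the step preserves this set
of copies. -/
theorem weight_add_weight_of_kempeStep {c d : (blowup G a).Coloring (Fin k)} {α β : Fin k}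
    (hαβ : α ≠ β) (h : ∀ x, c x = d x ∨ ((c x = α ∨ c x = β) ∧ (d x = α ∨ d x = β))) :
    weight (colorClass c α) + weight (colorClass c β) =
      weight (colorClass d α) + weight (colorClass d β) := by
  classical
  have key : ∀ (e : (blowup G a).Coloring (Fin k)) (v : V),
      (weight (colorClass e α) + weight (colorClass e β)) (some v) =
        (Finset.univ.filter fun j => e ⟨v, j⟩ = α ∨ e ⟨v, j⟩ = β).card := by
    intro e v
    rw [Finsupp.add_apply, weight_colorClass_some, weight_colorClass_some, Finset.filter_or,
      Finset.card_union_of_disjoint]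
    rw [Finset.disjoint_filter]
    rintro j - h₁ h₂
    exact hαβ (h₁.symm.trans h₂)
  ext o
  cases o with
  | none => simp
  | some v =>
    rw [key, key]
    congr 1
    ext j
    have := h ⟨v, j⟩
    simp only [Finset.mem_filter, Finset.mem_univ, true_and]
    rcases this with h | ⟨h, h'⟩
    · rw [h]
    · exact iff_of_true h h'

theorem colorClass_eq_of_kempeStep {c d : (blowup G a).Coloring (Fin k)} {α β i : Fin k}
    (h : ∀ x, c x = d x ∨ ((c x = α ∨ c x = β) ∧ (d x = α ∨ d x = β)))
    (hα : i ≠ α) (hβ : i ≠ β) : colorClass c i = colorClass d i := by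
  ext v
  rw [mem_colorClass, mem_colorClass]
  refine exists_congr fun j => ?_
  have := h ⟨v, j⟩
  grind

open Classical in
-- The copies of `v` are matched with the indices `i` such that `v ∈ S i`, and each copy is colored
-- by its index.
theorem exists_colorClass_eq (S : Fin k → StableSet G)
    (hS : ∀ v, (Finset.univ.filter fun i => v ∈ (S i).1).card = a v) :
    ∃ c : (blowup G a).Coloring (Fin k), ∀ i, colorClass c i = S i := by
  let e : ∀ v, Fin (a v) ≃ {i // v ∈ (S i).1} := fun v =>
    (Fintype.equivFinOfCardEq (by rw [Fintype.card_subtype, hS])).symm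
  refine ⟨Coloring.mk (fun p => (e p.1 p.2).1) ?_, fun i => ?_⟩
  · rintro ⟨v, j⟩ ⟨w, j'⟩ h heq
    simp only at heq
    rcases h with h | ⟨h, hne⟩
    · have h₁ := (e v j).2
      have h₂ := (e w j').2
      rw [← heq] at h₂
      exact (S _).2 h₁ h₂ h.ne h
    · simp only at h
      subst h
      exact hne (by rw [(e v).injective (Subtype.ext heq)])
  · ext v
    rw [mem_colorClass]
    constructor
    · rintro ⟨j, rfl⟩
      exact (e v j).2
    · intro h
      exact ⟨(e v).symm ⟨i, h⟩, congrArg Subtype.val ((e v).apply_symm_apply ⟨i, h⟩)⟩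

end ColorClasses

/-! ### Quadratic generation from Kempe equivalence -/

section Quadratic

variable (K : Type v) [Field K] {V : Type u} (G : SimpleGraph V)

/-- The ideal generated by the quadratic binomials of the stable set ideal. -/
noncomputable def quadraticIdeal : Ideal (MvPolynomial (StableSet G) K) :=
  Ideal.span {f | IsQuadraticBinomial f ∧ f ∈ stableSetIdeal K G}

variable {G}

theorem mk_X_mul_X {A B C D : StableSet G} (h : weight A + weight B = weight C + weight D) :
    Ideal.Quotient.mk (quadraticIdeal K G) (X A * X B) =
      Ideal.Quotient.mk (quadraticIdeal K G) (X C * X D) :=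
  Ideal.Quotient.eq.2 <|
    Ideal.subset_span ⟨⟨A, B, C, D, rfl⟩, (X_mul_X_sub_mem_iff K A B C D).2 h⟩

variable [Finite V]

theorem KempeStep.mk_prod_colorClass {a : V → ℕ} {k : ℕ} {c d : (blowup G a).Coloring (Fin k)}
    (h : KempeStep c d) :
    Ideal.Quotient.mk (quadraticIdeal K G) (∏ i, X (colorClass c i)) =
      Ideal.Quotient.mk (quadraticIdeal K G) (∏ i, X (colorClass d i)) := by
  obtain ⟨α, β, h⟩ := h
  by_cases hαβ : α = β
  · have hcd : c = d := by
      ext1 x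
      have := h x
      grind
    rw [hcd]
  have hβ : β ∈ Finset.univ.erase α := by simp [Ne.symm hαβ]
  rw [← Finset.mul_prod_erase _ _ (Finset.mem_univ α), ← Finset.mul_prod_erase _ _ hβ,
    ← Finset.mul_prod_erase _ (fun i => X (colorClass d i)) (Finset.mem_univ α),
    ← Finset.mul_prod_erase _ (fun i => X (colorClass d i)) hβ, ← mul_assoc, ← mul_assoc, map_mul,
    map_mul _ (X _ * X _), mk_X_mul_X K (weight_add_weight_of_kempeStep hαβ h)]
  congr 2
  refine Finset.prod_congr rfl fun i hi => ?_
  simp only [Finset.mem_erase, Finset.mem_univ, and_true] at hi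
  rw [colorClass_eq_of_kempeStep h hi.2 hi.1]

theorem KempeEquiv.mk_prod_colorClass {a : V → ℕ} {k : ℕ} {c d : (blowup G a).Coloring (Fin k)}
    (h : KempeEquiv c d) :
    Ideal.Quotient.mk (quadraticIdeal K G) (∏ i, X (colorClass c i)) =
      Ideal.Quotient.mk (quadraticIdeal K G) (∏ i, X (colorClass d i)) := by
  induction h with
  | refl => rfl
  | tail _ h ih => exact ih.trans (h.mk_prod_colorClass K)

theorem mk_monomial_eq_of_kempeEquiv
    (hG : ∀ (a : V → ℕ) (k : ℕ) (c d : (blowup G a).Coloring (Fin k)), KempeEquiv c d)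
    {m n : StableSet G →₀ ℕ}
    (h : aeval (stableMonomial K G) (monomial m (1 : K)) =
      aeval (stableMonomial K G) (monomial n (1 : K))) :
    Ideal.Quotient.mk (quadraticIdeal K G) (monomial m 1) =
      Ideal.Quotient.mk (quadraticIdeal K G) (monomial n 1) := by
  classical
  obtain ⟨k, S, hS⟩ := exists_monomial_eq_prod K m
  obtain ⟨l, T, hT⟩ := exists_monomial_eq_prod K n
  rw [hS, hT, aeval_prod_X, aeval_prod_X, (monomial_left_injective one_ne_zero).eq_iff] at h
  obtain rfl : k = l := by
    simpa only [sum_weight_none, Finset.card_univ, Fintype.card_fin] using DFunLike.congr_fun h none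
  obtain ⟨c, hc⟩ := exists_colorClass_eq S fun v => rfl
  obtain ⟨d, hd⟩ := exists_colorClass_eq 
    -- Equal images make the clique sizes computed from `S` also those of `T`, so both color the
    -- same blow-up.
    (a := fun v => (Finset.univ.filter fun i => v ∈ (S i).1).card) T fun v => by
    have := DFunLike.congr_fun h (some v)
    rw [sum_weight_some, sum_weight_some] at this
    exact this.symm
  rw [hS, hT]
  simpa only [hc, hd] using (hG _ _ c d).mk_prod_colorClass K

/-- If all colorings of all blow-ups of `G` are Kempe equivalent, then `K[G]` is quadratic. -/
theorem isQuadratic_of_kempeEquiv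
    (hG : ∀ (a : V → ℕ) (k : ℕ) (c d : (blowup G a).Coloring (Fin k)), KempeEquiv c d) :
    IsQuadratic K G := by
  classical
  refine ⟨{f | IsQuadraticBinomial f ∧ f ∈ stableSetIdeal K G}, fun f hf => hf.1,
    le_antisymm (Ideal.span_le.2 fun f hf => hf.2) fun p hp => ?_⟩
  change p ∈ quadraticIdeal K G
  let q := Ideal.Quotient.mkₐ K (quadraticIdeal K G)
  -- Since the class of a monomial depends only on its image, the quotient map factors linearly
  -- through the monomial map. The value 0 outside the image is never reached.
  let L : MvPolynomial (Option V) K →ₗ[K] MvPolynomial (StableSet G) K ⧸ quadraticIdeal K G :=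
    (basisMonomials (Option V) K).constr K fun w =>
      if h : ∃ m, aeval (stableMonomial K G) (monomial m (1 : K)) = monomial w (1 : K) then
        q (monomial h.choose 1) else 0
  have hL : L ∘ₗ (aeval (stableMonomial K G)).toLinearMap = q.toLinearMap := by
    refine (basisMonomials (StableSet G) K).ext fun m => ?_
    simp only [coe_basisMonomials, LinearMap.comp_apply, AlgHom.toLinearMap_apply]
    obtain ⟨k, S, hS⟩ := exists_monomial_eq_prod K m
    have hw := aeval_prod_X K Finset.univ S
    rw [← hS] at hw
    have hex : ∃ m, aeval (stableMonomial K G) (monomial m (1 : K)) =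
        monomial (∑ i, weight (S i)) (1 : K) := ⟨m, hw⟩
    have := (basisMonomials (Option V) K).constr_basis K (fun w =>
      if h : ∃ m, aeval (stableMonomial K G) (monomial m (1 : K)) = monomial w (1 : K) then
        q (monomial h.choose 1) else 0) (∑ i, weight (S i))
    rw [coe_basisMonomials, dif_pos hex] at this
    rw [hw]
    exact this.trans (mk_monomial_eq_of_kempeEquiv K hG (hex.choose_spec.trans hw.symm))
  have := DFunLike.congr_fun hL p
  simp only [LinearMap.comp_apply, AlgHom.toLinearMap_apply,
    (mem_stableSetIdeal_iff K p).1 hp, map_zero] at this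
  exact Ideal.Quotient.eq_zero_iff_mem.1 this.symm

end Quadratic

/-! ### Odd holes and odd antiholes in perfect graphs -/

section Perfect

theorem IsPerfect.exists_isClique_colorable {V : Type u} [Finite V] {G : SimpleGraph V}
    (hG : IsPerfect G) {W : Type*} {H : SimpleGraph W} (h : H.IsIndContained G) :
    ∃ s : Finset W, H.IsClique (s : Set W) ∧ H.Colorable s.card := by
  classical
  obtain ⟨f⟩ := h
  have hs := hG (Set.range f)
  obtain ⟨s, hs', hcard⟩ := (G.induce (Set.range f)).exists_isNClique_cliqueNum
  have hcol : (G.induce (Set.range f)).Colorable s.card := by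
    rw [← chromaticNumber_le_iff_colorable, hs, hcard]
  choose g hg using fun x : Set.range f => x.2
  have hginj : Function.Injective g := fun x y h => Subtype.ext (by rw [← hg x, ← hg y, h])
  refine ⟨s.image g, ?_, ?_⟩
  · intro a ha b hb hab
    simp only [Finset.coe_image, Set.mem_image, Finset.mem_coe] at ha hb
    obtain ⟨x, hx, rfl⟩ := ha
    obtain ⟨y, hy, rfl⟩ := hb
    have := hs' hx hy fun h => hab (congrArg g h)
    rw [← f.map_adj_iff, hg, hg]
    exact this
  · rw [Finset.card_image_of_injective s hginj]
    obtain ⟨c⟩ := hcol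
    exact ⟨Coloring.mk (fun x => c ⟨f x, x, rfl⟩) fun {x y} hxy =>
      c.valid (show G.Adj (f x) (f y) from f.map_adj_iff.2 hxy)⟩

theorem card_le_two_of_isClique_cycleGraph {n : ℕ} (hn : 5 ≤ n) {s : Finset (Fin n)}
    (hs : (cycleGraph n).IsClique (s : Set (Fin n))) : s.card ≤ 2 := by
  by_contra! h
  obtain ⟨a, ha, b, hb, c, hc, hab, hac, hbc⟩ := Finset.two_lt_card.1 h
  have h₁ := hs ha hb hab
  have h₂ := hs ha hc hac
  have h₃ := hs hb hc hbc
  rw [cycleGraph_adj_iff_val (by omega)] at h₁ h₂ h₃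
  rw [Ne, Fin.ext_iff] at hab hac hbc
  omega

/-- Such a clique has no two consecutive vertices, so it is disjoint from its shift by one. -/
theorem two_mul_card_le_of_isClique_compl_cycleGraph {n : ℕ} (hn : 5 ≤ n) {s : Finset (Fin n)}
    (hs : (cycleGraph n)ᶜ.IsClique (s : Set (Fin n))) : 2 * s.card ≤ n := by
  classical
  choose g _ hg using fun x : Fin n => exists_cycleGraph_neighbors hn x
  have hg' : ∀ x, (g x).val = x.val + 1 ∧ x.val + 1 < n ∨ (g x).val = 0 ∧ x.val + 1 = n :=
    fun x => (hg x).1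
  have hinj : Function.Injective g := by
    intro x y hxy
    have hx := hg' x
    have hy := hg' y
    rw [hxy] at hx
    ext
    omega
  have hdisj : Disjoint s (s.image g) := by
    rw [Finset.disjoint_right]
    intro y hy hys
    obtain ⟨x, hx, rfl⟩ := Finset.mem_image.1 hy
    have hgx := hg' x
    have hne : x ≠ g x := by rw [Ne, Fin.ext_iff]; omega
    have := hs hx hys hne
    rw [compl_adj, cycleGraph_adj_iff_val (by omega)] at this
    omega
  have := Finset.card_le_univ (s ∪ s.image g)
  rw [Finset.card_union_of_disjoint hdisj, Finset.card_image_of_injective s hinj,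
    Fintype.card_fin] at this
  omega

variable {V : Type u} [Finite V] {G : SimpleGraph V}

theorem IsPerfect.not_hasOddHole (hG : IsPerfect G) : ¬ HasOddHole G := by
  rintro ⟨n, hn, hodd, h⟩
  obtain ⟨s, hs, hcol⟩ := hG.exists_isClique_colorable h
  have h₂ := (hcol.mono (card_le_two_of_isClique_cycleGraph hn hs)).chromaticNumber_le
  rw [chromaticNumber_cycleGraph_of_odd n (by omega) hodd] at h₂
  exact absurd h₂ (by decide)

/-- Color classes are cliques of the cycle, of size at most 2, so `n ≤ 2 * s.card`; the clique bound
is the reverse inequality. -/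
theorem IsPerfect.even_of_compl_cycleGraph (hG : IsPerfect G) {n : ℕ} (hn : 5 ≤ n)
    (h : ((cycleGraph n)ᶜ).IsIndContained G) : Even n := by
  classical
  obtain ⟨s, hs, ⟨c⟩⟩ := hG.exists_isClique_colorable h
  have h₁ := two_mul_card_le_of_isClique_compl_cycleGraph hn hs
  have h₂ := Finset.card_le_mul_card_image_of_maps_to (s := Finset.univ) (t := Finset.univ)
    (f := c) (fun _ _ => Finset.mem_univ _) 2 fun i _ => by
      refine card_le_two_of_isClique_cycleGraph hn fun a ha b hb hab => ?_
      by_contra hadj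
      simp only [Finset.coe_filter, Finset.mem_univ, true_and, Set.mem_ofPred_eq] at ha hb
      exact c.valid ((compl_adj _ _ _).2 ⟨hab, hadj⟩) (ha.trans hb.symm)
  simp only [Finset.card_univ, Fintype.card_fin] at h₂
  exact ⟨s.card, by omega⟩

end Perfect

/-! ### Rigid fibers obstruct quadratic generation -/

section Rigid

theorem weight_add_weight_eq_iff {V : Type u} {G : SimpleGraph V} {A B C D : StableSet G} :
    weight A + weight B = weight C + weight D ↔
      ∀ v, ((v ∈ A.1 ∨ v ∈ B.1) ↔ (v ∈ C.1 ∨ v ∈ D.1)) ∧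
        ((v ∈ A.1 ∧ v ∈ B.1) ↔ (v ∈ C.1 ∧ v ∈ D.1)) := by
  classical
  have key : ∀ v, (weight A + weight B) (some v) = (weight C + weight D) (some v) ↔
      ((v ∈ A.1 ∨ v ∈ B.1) ↔ (v ∈ C.1 ∨ v ∈ D.1)) ∧
        ((v ∈ A.1 ∧ v ∈ B.1) ↔ (v ∈ C.1 ∧ v ∈ D.1)) := by
    intro v
    simp only [Finsupp.add_apply, weight_some]
    by_cases h₁ : v ∈ A.1 <;> by_cases h₂ : v ∈ B.1 <;> by_cases h₃ : v ∈ C.1 <;>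
      by_cases h₄ : v ∈ D.1 <;> simp [h₁, h₂, h₃, h₄]
  constructor
  · exact fun h v => (key v).1 (DFunLike.congr_fun h _)
  · intro h
    ext o
    cases o with
    | none => simp
    | some v => exact (key v).2 (h v)

/-- Some fiber of the monomial map contains, besides another element, a product of distinct
variables to which no nontrivial quadratic move applies. -/
def HasRigidFiber {V : Type u} (G : SimpleGraph V) : Prop :=
  ∃ (k : ℕ) (S T : Fin k → StableSet G), Function.Injective S ∧ (∃ i, ∀ j, T i ≠ S j) ∧
    (∑ i, weight (S i) = ∑ i, weight (T i)) ∧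
    ∀ i j, i ≠ j → ∀ C D, weight (S i) + weight (S j) = weight C + weight D →
      (C = S i ∧ D = S j) ∨ (C = S j ∧ D = S i)

/-- Exchanging `C` and `D` if needed, `x` lies in `C`; the two inclusions are then equalities
because the total weights agree. -/
theorem hasRigidFiber_of_separating {V : Type u} {G : SimpleGraph V} {k : ℕ}
    (S T : Fin k → StableSet G) (hT : ∃ i, ∀ j, T i ≠ S j)
    (hw : ∑ i, weight (S i) = ∑ i, weight (T i))
    (h : ∀ i j, i ≠ j → ∃ x ∈ (S i).1, x ∉ (S j).1 ∧ ∀ C D : StableSet G,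
      weight (S i) + weight (S j) = weight C + weight D → x ∈ C.1 →
        (S i).1 ⊆ C.1 ∧ (S j).1 ⊆ D.1) : HasRigidFiber G := by
  refine ⟨k, S, T, ?_, hT, hw, ?_⟩
  · intro i j hij
    by_contra hne
    obtain ⟨x, hx, hx', -⟩ := h i j hne
    exact hx' (hij ▸ hx)
  · intro i j hij C D hCD
    obtain ⟨x, hx, hx', hmove⟩ := h i j hij
    have key : ∀ C D : StableSet G, weight (S i) + weight (S j) = weight C + weight D → x ∈ C.1 →
        C = S i ∧ D = S j := by
      intro C D hCD hxC
      obtain ⟨h₁, h₂⟩ := hmove C D hCD hxC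
      rw [weight_add_weight_eq_iff] at hCD
      constructor <;> ext v <;> have := hCD v <;> have := @h₁ v <;> have := @h₂ v <;> tauto
    rcases ((weight_add_weight_eq_iff.1 hCD x).1.1 (Or.inl hx)) with hC | hD
    · exact Or.inl (key C D hCD hC)
    · exact Or.inr (key D C (by rw [hCD, add_comm]) hD).symm

/-- The image of a stable set under an embedding of graphs. -/
def mapStableSet {V : Type u} {W : Type*} {G : SimpleGraph V} {H : SimpleGraph W} (f : H ↪g G)
    (S : StableSet H) : StableSet G :=
  ⟨S.1.map f.toEmbedding, by
    intro a ha b hb hab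
    simp only [Finset.coe_map, Set.mem_image, Finset.mem_coe] at ha hb
    obtain ⟨x, hx, rfl⟩ := ha
    obtain ⟨y, hy, rfl⟩ := hb
    exact fun h => S.2 hx hy (fun h => hab (congrArg _ h)) (f.map_adj_iff.1 h)⟩

section Map

variable {V : Type u} {W : Type*} {G : SimpleGraph V} {H : SimpleGraph W} (f : H ↪g G)

theorem map_mem_mapStableSet {S : StableSet H} {x : W} : f x ∈ (mapStableSet f S).1 ↔ x ∈ S.1 :=
  Finset.mem_map' f.toEmbedding

theorem exists_of_mem_mapStableSet {S : StableSet H} {v : V} (h : v ∈ (mapStableSet f S).1) :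
    ∃ x ∈ S.1, f x = v :=
  Finset.mem_map.1 h

theorem mapStableSet_injective : Function.Injective (mapStableSet f) := by
  intro S T h
  ext x
  rw [← map_mem_mapStableSet f, h, map_mem_mapStableSet]

theorem exists_mapStableSet_eq (C : StableSet G) (hC : ∀ v ∈ C.1, v ∈ Set.range f) :
    ∃ C' : StableSet H, mapStableSet f C' = C := by
  classical
  refine ⟨⟨C.1.preimage f f.injective.injOn, ?_⟩, ?_⟩
  · intro a ha b hb hab h
    simp only [Finset.coe_preimage, Set.mem_preimage, Finset.mem_coe] at ha hb
    exact C.2 ha hb (f.injective.ne hab) (f.map_adj_iff.2 h)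
  · ext v
    constructor
    · intro h
      obtain ⟨x, hx, rfl⟩ := exists_of_mem_mapStableSet f h
      simpa using hx
    · intro h
      obtain ⟨x, rfl⟩ := hC v h
      exact (map_mem_mapStableSet f).2 (by simpa using h)

theorem weight_mapStableSet (S : StableSet H) :
    weight (mapStableSet f S) = (weight S).mapDomain (Option.map f) := by
  classical
  simp only [weight, mapStableSet, Finset.sum_map, Finsupp.mapDomain_add,
    Finsupp.mapDomain_finsetSum, Finsupp.mapDomain_single, Option.map_some, Option.map_none]
  rfl

/-- A move in `G` only involves vertices already covered, so it takes place inside the copy of `H`.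
-/
theorem HasRigidFiber.of_isIndContained (hH : HasRigidFiber H) (h : H.IsIndContained G) :
    HasRigidFiber G := by
  obtain ⟨f⟩ := h
  obtain ⟨k, S, T, hS, ⟨i₀, hi₀⟩, hw, hrigid⟩ := hH
  have hinj : Function.Injective (Finsupp.mapDomain (M := ℕ) (Option.map f)) :=
    Finsupp.mapDomain_injective (Option.map_injective f.injective)
  refine ⟨k, fun i => mapStableSet f (S i), fun i => mapStableSet f (T i),
    (mapStableSet_injective f).comp hS,
    ⟨i₀, fun j hj => hi₀ j (mapStableSet_injective f hj)⟩, ?_, ?_⟩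
  · simp only [weight_mapStableSet, ← Finsupp.mapDomain_finsetSum, hw]
  · intro i j hij C D hCD
    have hmem := weight_add_weight_eq_iff.1 hCD
    have hrange : ∀ v, v ∈ C.1 ∨ v ∈ D.1 → v ∈ Set.range f := by
      intro v hv
      rcases (hmem v).1.2 hv with h | h <;>
      · obtain ⟨x, -, rfl⟩ := exists_of_mem_mapStableSet f h
        exact ⟨x, rfl⟩
    obtain ⟨C, rfl⟩ := exists_mapStableSet_eq f C fun v hv => hrange v (Or.inl hv)
    obtain ⟨D, rfl⟩ := exists_mapStableSet_eq f D fun v hv => hrange v (Or.inr hv)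
    simp only [weight_mapStableSet, ← Finsupp.mapDomain_add] at hCD
    exact (hrigid i j hij C D (hinj hCD)).imp
      (fun h => ⟨congrArg _ h.1, congrArg _ h.2⟩) fun h => ⟨congrArg _ h.1, congrArg _ h.2⟩

end Map

theorem HasRigidFiber.not_isQuadratic (K : Type v) [Field K] {V : Type u} {G : SimpleGraph V}
    (hG : HasRigidFiber G) : ¬ IsQuadratic K G := by
  classical
  rintro ⟨B, hB, hspan⟩
  obtain ⟨k, S, T, hS, ⟨i₀, hi₀⟩, hw, hrigid⟩ := hG
  let m : StableSet G →₀ ℕ := ∑ i, Finsupp.single (S i) 1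
  let n : StableSet G →₀ ℕ := ∑ i, Finsupp.single (T i) 1
  have hm : ∀ A, m A = if ∃ i, S i = A then 1 else 0 := by
    intro A
    simp only [m, Finsupp.finsetSum_apply, Finsupp.single_apply]
    split_ifs with h
    · obtain ⟨i, rfl⟩ := h
      simp [hS.eq_iff]
    · exact Finset.sum_eq_zero fun i _ => if_neg fun hi => h ⟨i, hi⟩
  have hne : n ≠ m := by
    intro h
    have h₁ := DFunLike.congr_fun h (T i₀)
    rw [hm, if_neg fun ⟨j, hj⟩ => hi₀ j hj.symm] at h₁
    simp only [n, Finsupp.finsetSum_apply] at h₁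
    have := Finset.sum_eq_zero_iff.1 h₁ i₀ (Finset.mem_univ _)
    simp at this
  -- A quadratic monomial dividing the squarefree `m` is a product of two distinct `S i`, so by
  -- rigidity its binomial vanishes.
  have hle : ∀ A B C D : StableSet G, weight A + weight B = weight C + weight D →
      Finsupp.single A 1 + Finsupp.single B 1 ≤ m →
        (X A * X B : MvPolynomial (StableSet G) K) = X C * X D := by
    intro A B C D hABCD hAB
    have hA := hAB A
    have hB := hAB B
    rw [hm] at hA hB
    simp only [Finsupp.add_apply, Finsupp.single_eq_same] at hA hB
    obtain ⟨i, rfl⟩ : ∃ i, S i = A := by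
      by_contra h
      rw [if_neg h] at hA
      omega
    obtain ⟨j, rfl⟩ : ∃ j, S j = B := by
      by_contra h
      rw [if_neg h] at hB
      omega
    have hij : i ≠ j := by
      rintro rfl
      simp at hA
    rcases hrigid i j hij C D hABCD with ⟨rfl, rfl⟩ | ⟨rfl, rfl⟩
    · rfl
    · exact mul_comm _ _
  have hmono : ∀ A B : StableSet G, (X A * X B : MvPolynomial (StableSet G) K) =
      monomial (Finsupp.single A 1 + Finsupp.single B 1) 1 := by
    intro A B
    simp only [X, monomial_mul, mul_one]
  -- Hence the coefficient of `m` vanishes on the whole ideal, while it is 1 in the binomial of the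
  -- fiber.
  have hzero : ∀ f ∈ Ideal.span B, ∀ g, coeff m (g * f) = 0 := by
    intro f hf
    induction hf using Submodule.span_induction with
    | mem f hf =>
      intro g
      have hmem : f ∈ stableSetIdeal K G := hspan ▸ Ideal.subset_span hf
      obtain ⟨A, B, C, D, rfl⟩ := hB f hf
      rw [X_mul_X_sub_mem_iff] at hmem
      by_cases h₁ : Finsupp.single A 1 + Finsupp.single B 1 ≤ m
      · simp [hle A B C D hmem h₁]
      by_cases h₂ : Finsupp.single C 1 + Finsupp.single D 1 ≤ m
      · simp [hle C D A B hmem.symm h₂]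
      rw [mul_sub, coeff_sub, hmono, hmono, coeff_mul_monomial', coeff_mul_monomial', if_neg h₁,
        if_neg h₂, sub_zero]
    | zero => simp
    | add f g _ _ hf hg => intro h; rw [mul_add, coeff_add, hf, hg, add_zero]
    | smul a f _ hf => intro h; rw [smul_eq_mul, ← mul_assoc, hf]
  have hmem : monomial m 1 - monomial n 1 ∈ stableSetIdeal K G := by
    have h₁ : ∀ R : Fin k → StableSet G, monomial (∑ i, Finsupp.single (R i) 1) (1 : K) =
        ∏ i, X (R i) := fun R => monomial_sum_one _ _
    rw [mem_stableSetIdeal_iff, map_sub, h₁, h₁, aeval_prod_X, aeval_prod_X, hw, sub_self]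
  rw [← hspan] at hmem
  have := hzero _ hmem 1
  rw [one_mul, coeff_sub, coeff_monomial, coeff_monomial, if_pos rfl, if_neg hne, sub_zero] at this
  exact one_ne_zero this

end Rigid

theorem sum_weight_eq_of_card_eq {V : Type u} {G : SimpleGraph V} {k : ℕ}
    {S T : Fin k → StableSet G}
    (h : ∀ v, Nat.card {i // v ∈ (S i).1} = Nat.card {i // v ∈ (T i).1}) :
    ∑ i, weight (S i) = ∑ i, weight (T i) := by
  classical
  ext o
  cases o with
  | none => rw [sum_weight_none, sum_weight_none]
  | some v =>
    have := h v
    rw [sum_weight_some, sum_weight_some]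
    simpa [Fintype.card_subtype] using this

/-! ### Even antiholes: the two perfect matchings of an even cycle -/

section Antihole

/-- The `i`-th edge of one of the two perfect matchings of the cycle of length `2 * m`. -/
def matchingEdge (m : ℕ) (hm : 3 ≤ m) (shift : Bool) (i : Fin m) :
    StableSet (cycleGraph (2 * m))ᶜ :=
  ⟨Finset.univ.filter fun v => if shift then
      v.val = 2 * i.val + 1 ∨ v.val = 2 * i.val + 2 ∨ (v.val = 0 ∧ 2 * i.val + 2 = 2 * m)
    else v.val = 2 * i.val ∨ v.val = 2 * i.val + 1, by
    intro a ha b hb hab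
    have := a.isLt
    have := b.isLt
    simp only [Finset.coe_filter, Finset.mem_univ, true_and, Set.mem_ofPred_eq] at ha hb
    rw [Ne, Fin.ext_iff] at hab
    rw [compl_adj, cycleGraph_adj_iff_val (by omega)]
    cases shift <;> simp at ha hb <;> omega⟩

theorem mem_matchingEdge_false {m : ℕ} {hm : 3 ≤ m} {i : Fin m} {v : Fin (2 * m)} :
    v ∈ (matchingEdge m hm false i).1 ↔ v.val = 2 * i.val ∨ v.val = 2 * i.val + 1 := by
  simp [matchingEdge]

theorem mem_matchingEdge_true {m : ℕ} {hm : 3 ≤ m} {i : Fin m} {v : Fin (2 * m)} :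
    v ∈ (matchingEdge m hm true i).1 ↔ v.val = 2 * i.val + 1 ∨ v.val = 2 * i.val + 2 ∨
      (v.val = 0 ∧ 2 * i.val + 2 = 2 * m) := by
  simp [matchingEdge]

theorem card_matchingEdge {m : ℕ} {hm : 3 ≤ m} (shift : Bool) (v : Fin (2 * m)) :
    Nat.card {i // v ∈ (matchingEdge m hm shift i).1} = 1 := by
  have hv := v.isLt
  rw [Nat.card_eq_one_iff_unique]
  cases shift
  · simp only [mem_matchingEdge_false]
    refine ⟨⟨fun a b => ?_⟩, ⟨⟨⟨v.val / 2, by omega⟩, by simp only; omega⟩⟩⟩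
    have ha := a.2
    have hb := b.2
    ext
    omega
  · simp only [mem_matchingEdge_true]
    refine ⟨⟨fun a b => ?_⟩, ?_⟩
    · have ha := a.2
      have hb := b.2
      have ha' := a.1.isLt
      have hb' := b.1.isLt
      ext
      omega
    · rcases Nat.eq_zero_or_pos v.val with h | h
      · exact ⟨⟨⟨m - 1, by omega⟩, by simp only; omega⟩⟩
      · exact ⟨⟨⟨(v.val - 1) / 2, by omega⟩, by simp only; omega⟩⟩

theorem StableSet.adj_of_mem_compl {n : ℕ} (hn : 3 ≤ n) (C : StableSet (cycleGraph n)ᶜ)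
    {a b : Fin n} (ha : a ∈ C.1) (hb : b ∈ C.1) :
    a.val = b.val ∨ a.val + 1 = b.val ∨ b.val + 1 = a.val ∨
      (a.val = 0 ∧ b.val + 1 = n) ∨ (b.val = 0 ∧ a.val + 1 = n) := by
  by_cases h : a = b
  · exact Or.inl (congrArg _ h)
  · have : ¬ (cycleGraph n)ᶜ.Adj a b := C.2 ha hb h
    rw [compl_adj, not_and_not_right, cycleGraph_adj_iff_val hn] at this
    exact Or.inr (this h)

theorem hasRigidFiber_compl_cycleGraph {m : ℕ} (hm : 3 ≤ m) :
    HasRigidFiber (cycleGraph (2 * m))ᶜ := by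
  refine hasRigidFiber_of_separating (matchingEdge m hm false) (matchingEdge m hm true)
    ⟨⟨0, by omega⟩, fun j hj => ?_⟩
    (sum_weight_eq_of_card_eq fun v => by rw [card_matchingEdge, card_matchingEdge]) ?_
  · have h₁ : (⟨1, by omega⟩ : Fin (2 * m)) ∈ (matchingEdge m hm true ⟨0, by omega⟩).1 := by
      rw [mem_matchingEdge_true]; simp
    have h₂ : (⟨2, by omega⟩ : Fin (2 * m)) ∈ (matchingEdge m hm true ⟨0, by omega⟩).1 := by
      rw [mem_matchingEdge_true]; simp
    rw [hj, mem_matchingEdge_false] at h₁ h₂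
    simp only at h₁ h₂
    omega
  · intro i j hij
    have hi := i.isLt
    have hj := j.isLt
    rw [Ne, Fin.ext_iff] at hij
    let p : Fin (2 * m) := ⟨2 * i.val, by omega⟩
    let p' : Fin (2 * m) := ⟨2 * i.val + 1, by omega⟩
    let q : Fin (2 * m) := ⟨2 * j.val, by omega⟩
    let q' : Fin (2 * m) := ⟨2 * j.val + 1, by omega⟩
    refine ⟨p, mem_matchingEdge_false.2 (Or.inl rfl), ?_, ?_⟩
    · rw [mem_matchingEdge_false]
      simp only [p]
      omega
    intro C D hCD hp
    rw [weight_add_weight_eq_iff] at hCD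
    have hadjC := fun a b => StableSet.adj_of_mem_compl (by omega) C (a := a) (b := b)
    have hadjD := fun a b => StableSet.adj_of_mem_compl (by omega) D (a := a) (b := b)
    have hp' := (hCD p').1.1 (Or.inl (mem_matchingEdge_false.2 (Or.inr rfl)))
    have hq := (hCD q).1.1 (Or.inr (mem_matchingEdge_false.2 (Or.inl rfl)))
    have hq' := (hCD q').1.1 (Or.inr (mem_matchingEdge_false.2 (Or.inr rfl)))
    -- Vertices of equal parity are never consecutive on an even cycle.
    have hqD : q ∈ D.1 := hq.resolve_left fun h => by
      have := hadjC p q hp h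
      simp only [p, q] at this
      omega
    -- Otherwise `q` follows `p'`, and `q'` fits nowhere: not with `p'` by parity, nor with `p`,
    -- since that would force `m ≤ 2`.
    have hp'C : p' ∈ C.1 := by
      refine hp'.resolve_right fun h => ?_
      have h₁ := hadjD p' q h hqD
      rcases hq' with hq' | hq'
      · have h₂ := hadjC p q' hp hq'
        simp only [p, p', q, q'] at h₁ h₂
        omega
      · have h₂ := hadjD p' q' h hq'
        simp only [p', q'] at h₂
        omega
    have hq'D : q' ∈ D.1 := hq'.resolve_left fun h => by
      have := hadjC p' q' hp'C h
      simp only [p', q'] at this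
      omega
    constructor <;> intro v hv <;> rw [mem_matchingEdge_false] at hv <;> rcases hv with hv | hv
    · rwa [show v = p from Fin.ext hv]
    · rwa [show v = p' from Fin.ext hv]
    · rwa [show v = q from Fin.ext hv]
    · rwa [show v = q' from Fin.ext hv]

end Antihole

/-! ### Odd prisms: two families of three stable sets -/

section Prism

variable {l : Fin 3 → ℕ} (hl : ∀ i, Odd (l i))

/-- The stable sets of an odd prism that contain every second vertex of the path `c`, the vertices
in between on the other two paths, and the last vertex of the path `c + d`. -/
def prismStableSet {d : Fin 3} (hd : d ≠ 0) (c : Fin 3) : StableSet (prismGraph l) :=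
  ⟨Finset.univ.filter fun x => (x.2.val = l x.1 ∧ x.1 = c + d) ∨
    (x.2.val < l x.1 ∧ (x.1 = c ↔ Even x.2.val)), by
    have hcd : c + d ≠ c := by simpa using hd
    rintro ⟨i, s⟩ hi ⟨j, t⟩ hj - hadj
    simp only [Finset.coe_filter, Finset.mem_univ, true_and, Set.mem_ofPred_eq] at hi hj
    have hli := hl i
    have hlj := hl j
    have hs := s.isLt
    have ht := t.isLt
    rcases hadj with ⟨h, h'⟩ | ⟨h, ⟨h₁, h₂⟩ | ⟨h₁, h₂⟩⟩
    · simp only at h h'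
      subst h
      by_cases hic : i = c
      · subst hic
        grind
      · grind
    · simp only at h h₁ h₂
      grind
    · simp only at h h₁ h₂
      grind⟩

theorem mem_prismStableSet {d : Fin 3} {hd : d ≠ 0} {c i : Fin 3} {s : Fin (l i + 1)} :
    (⟨i, s⟩ : Σ i : Fin 3, Fin (l i + 1)) ∈ (prismStableSet hl hd c).1 ↔
      (s.val = l i ∧ i = c + d) ∨ (s.val < l i ∧ (i = c ↔ Even s.val)) := by
  simp [prismStableSet]

theorem card_prismStableSet {d e : Fin 3} (hd : d ≠ 0) (he : e ≠ 0)
    (x : Σ i : Fin 3, Fin (l i + 1)) :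
    Nat.card {c // x ∈ (prismStableSet hl hd c).1} =
      Nat.card {c // x ∈ (prismStableSet hl he c).1} := by
  obtain ⟨i, s⟩ := x
  simp only [mem_prismStableSet]
  by_cases h : s.val = l i
  -- Only last vertices depend on `d`; the last vertex of path `i` is covered just by `c = i - d`,
  -- so a shift matches the counts.
  · refine Nat.card_congr ((Equiv.addRight (d - e)).subtypeEquiv fun c => ?_)
    simp only [h, lt_irrefl, false_and, or_false, true_and, Equiv.coe_addRight]
    rw [add_assoc, sub_add_cancel]
  · simp [h]

/-- Each vertex of path `c` before the last is covered, and neighbors cannot share a stable set, so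
membership alternates from `C`. -/
theorem prism_path_mem {c c' : Fin 3} (hcc : c ≠ c') {hd : (1 : Fin 3) ≠ 0}
    {C D : StableSet (prismGraph l)}
    (hCD : weight (prismStableSet hl hd c) + weight (prismStableSet hl hd c') =
      weight C + weight D) (hC : ⟨c, 0⟩ ∈ C.1) (t : ℕ) (ht : t < l c) :
    (Even t → ⟨c, ⟨t, by omega⟩⟩ ∈ C.1) ∧ (Odd t → ⟨c, ⟨t, by omega⟩⟩ ∈ D.1) := by
  rw [weight_add_weight_eq_iff] at hCD
  induction t with
  | zero => exact ⟨fun _ => hC, fun h => by simp at h⟩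
  | succ t ih =>
    have ih := ih (by omega)
    have hmem := (hCD ⟨c, ⟨t + 1, by omega⟩⟩).1
    rw [mem_prismStableSet, mem_prismStableSet] at hmem
    have hadj : (prismGraph l).Adj ⟨c, ⟨t, by omega⟩⟩ ⟨c, ⟨t + 1, by omega⟩⟩ :=
      Or.inl ⟨rfl, Or.inl rfl⟩
    have hnC := fun h₁ h₂ => C.2 h₁ h₂ hadj.ne hadj
    have hnD := fun h₁ h₂ => D.2 h₁ h₂ hadj.ne hadj
    simp only [Finset.mem_coe] at hnC hnD
    have hor : (⟨c, ⟨t + 1, by omega⟩⟩ : Σ i : Fin 3, Fin (l i + 1)) ∈ C.1 ∨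
        (⟨c, ⟨t + 1, by omega⟩⟩ : Σ i : Fin 3, Fin (l i + 1)) ∈ D.1 := by
      rw [← hmem]
      by_cases h : Even (t + 1)
      · exact Or.inl (Or.inr ⟨ht, by simp [h]⟩)
      · exact Or.inr (Or.inr ⟨ht, by simp [h, hcc]⟩)
    rw [Nat.even_add_one, Nat.odd_add_one, Nat.not_even_iff_odd, Nat.not_odd_iff_even]
    exact ⟨fun h => hor.resolve_right (hnD (ih.2 h)), fun h => hor.resolve_left (hnC (ih.1 h))⟩

/-- Both alternations are forced. As `l c'` is odd, the vertex before the end of path `c'` is in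
`D`, which pushes the end into `C`; the end triangle then pushes the end of the third path into `D`.
The other covered vertices of the third path lie in both sets. -/
theorem prismStableSet_subset {c c' : Fin 3} (hcc : c' = c + 1) {hd : (1 : Fin 3) ≠ 0}
    {C D : StableSet (prismGraph l)}
    (hCD : weight (prismStableSet hl hd c) + weight (prismStableSet hl hd c') =
      weight C + weight D) (hC : ⟨c, 0⟩ ∈ C.1) (hD : ⟨c', 0⟩ ∈ D.1) :
    (prismStableSet hl hd c).1 ⊆ C.1 ∧ (prismStableSet hl hd c').1 ⊆ D.1 := by
  have hne : c ≠ c' := by subst hcc; simp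
  have hpath := prism_path_mem hl hne hCD hC
  have hpath' := prism_path_mem hl hne.symm (hd := hd) (by rw [add_comm, hCD, add_comm]) hD
  rw [weight_add_weight_eq_iff] at hCD
  have hlast' : (⟨c', Fin.last _⟩ : Σ i : Fin 3, Fin (l i + 1)) ∈ C.1 := by
    have hlc := hl c'
    have hpos := hlc.pos
    have heven : Even (l c' - 1) := by grind
    refine ((hCD _).1.1 (Or.inl ((mem_prismStableSet hl).2 (Or.inl ⟨rfl, hcc⟩)))).resolve_right ?_
    intro h
    have hadj : (prismGraph l).Adj ⟨c', ⟨l c' - 1, by omega⟩⟩ ⟨c', Fin.last _⟩ :=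
      Or.inl ⟨rfl, Or.inl (by simp only [Fin.val_last]; omega)⟩
    exact D.2 ((hpath' _ (by omega)).1 heven) h hadj.ne hadj
  have hlast : (⟨c' + 1, Fin.last _⟩ : Σ i : Fin 3, Fin (l i + 1)) ∈ D.1 := by
    refine ((hCD _).1.1 (Or.inr ((mem_prismStableSet hl).2 (Or.inl ⟨rfl, rfl⟩)))).resolve_left ?_
    intro h
    have hadj : (prismGraph l).Adj ⟨c', Fin.last _⟩ ⟨c' + 1, Fin.last _⟩ :=
      Or.inr ⟨by simp, Or.inr ⟨rfl, rfl⟩⟩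
    exact C.2 hlast' h hadj.ne hadj
  have hboth : ∀ (i : Fin 3) (s : Fin (l i + 1)), i ≠ c → i ≠ c' → s.val < l i → ¬ Even s.val →
      (⟨i, s⟩ : Σ i : Fin 3, Fin (l i + 1)) ∈ C.1 ∧
        (⟨i, s⟩ : Σ i : Fin 3, Fin (l i + 1)) ∈ D.1 := fun i s h₁ h₂ hs hodd =>
    (hCD ⟨i, s⟩).2.1 ⟨(mem_prismStableSet hl).2 (Or.inr ⟨hs, iff_of_false h₁ hodd⟩),
      (mem_prismStableSet hl).2 (Or.inr ⟨hs, iff_of_false h₂ hodd⟩)⟩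
  constructor
  · rintro ⟨i, s⟩ h
    rcases (mem_prismStableSet hl).1 h with ⟨hs, hi⟩ | ⟨hs, hi⟩
    · obtain rfl : i = c' := hi.trans hcc.symm
      rwa [show s = Fin.last _ from Fin.ext hs]
    · by_cases h₁ : i = c
      · subst h₁
        exact (hpath s hs).1 (hi.1 rfl)
      by_cases h₂ : i = c'
      · subst h₂
        exact (hpath' s hs).2 (Nat.not_even_iff_odd.1 fun h => h₁ (hi.2 h))
      exact (hboth i s h₁ h₂ hs fun h => h₁ (hi.2 h)).1
  · rintro ⟨i, s⟩ h
    rcases (mem_prismStableSet hl).1 h with ⟨hs, rfl⟩ | ⟨hs, hi⟩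
    · rwa [show s = Fin.last _ from Fin.ext hs]
    · by_cases h₁ : i = c'
      · subst h₁
        exact (hpath' s hs).1 (hi.1 rfl)
      by_cases h₂ : i = c
      · subst h₂
        exact (hpath s hs).2 (Nat.not_even_iff_odd.1 fun h => h₁ (hi.2 h))
      exact (hboth i s h₂ h₁ hs fun h => h₁ (hi.2 h)).2

theorem hasRigidFiber_prismGraph {l : Fin 3 → ℕ} (hl : ∀ i, Odd (l i)) :
     HasRigidFiber (prismGraph l) := by
  have h₁ : (1 : Fin 3) ≠ 0 := by decide
  have h₂ : (2 : Fin 3) ≠ 0 := by decide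
  have hzero : ∀ c : Fin 3, (⟨c, 0⟩ : Σ i : Fin 3, Fin (l i + 1)) ∈
      (prismStableSet hl h₁ c).1 := fun c =>
    (mem_prismStableSet hl).2 (Or.inr ⟨(hl c).pos, by simp⟩)
  refine hasRigidFiber_of_separating (prismStableSet hl h₁) (prismStableSet hl h₂)
    ⟨0, fun j hj => ?_⟩ (sum_weight_eq_of_card_eq (card_prismStableSet hl h₁ h₂)) ?_
  · have ha : (⟨0, 0⟩ : Σ i : Fin 3, Fin (l i + 1)) ∈ (prismStableSet hl h₂ 0).1 :=
      (mem_prismStableSet hl).2 (Or.inr ⟨(hl 0).pos, by simp⟩)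
    have hb : (⟨2, Fin.last _⟩ : Σ i : Fin 3, Fin (l i + 1)) ∈ (prismStableSet hl h₂ 0).1 :=
      (mem_prismStableSet hl).2 (Or.inl ⟨rfl, rfl⟩)
    rw [hj, mem_prismStableSet] at ha hb
    have hpos := (hl 0).pos
    have hj₀ : (0 : Fin 3) = j := by
      rcases ha with ⟨h, -⟩ | ⟨-, h⟩
      · simp only [Fin.val_zero] at h
        omega
      · exact h.2 (by simp)
    subst hj₀
    rcases hb with ⟨-, h⟩ | ⟨h, -⟩
    · exact absurd h (by decide)
    · simp at h
  · intro c c' hcc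
    have hadj : (prismGraph l).Adj ⟨c, 0⟩ ⟨c', 0⟩ := Or.inr ⟨hcc, Or.inl ⟨rfl, rfl⟩⟩
    refine ⟨⟨c, 0⟩, hzero c, fun h => ?_, fun C D hCD hC => ?_⟩
    · exact (prismStableSet hl h₁ c').2 h (hzero c') hadj.ne hadj
    have hD : (⟨c', 0⟩ : Σ i : Fin 3, Fin (l i + 1)) ∈ D.1 :=
      ((weight_add_weight_eq_iff.1 hCD _).1.1 (Or.inr (hzero c'))).resolve_left fun h =>
        C.2 hC h hadj.ne hadj
    -- Any two of the three paths are cyclically consecutive in one order, so one orientation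
    -- suffices.
    have hcases : ∀ c c' : Fin 3, c ≠ c' → c' = c + 1 ∨ c = c' + 1 := by decide
    rcases hcases c c' hcc with h | h
    · exact prismStableSet_subset hl h hCD hC hD
    · exact (prismStableSet_subset hl h (by rw [add_comm, hCD, add_comm]) hD hC).symm

end Prism

theorem IsPerfect.isForbiddenFree_of_isQuadratic {K : Type v} [Field K] {V : Type u} [Finite V]
    {G : SimpleGraph V} (hG : IsPerfect G) (h : IsQuadratic K G) : IsForbiddenFree G := by
  refine ⟨hG.not_hasOddHole, ?_, ?_⟩
  · rintro ⟨n, hn, hcont⟩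
    obtain ⟨m, rfl⟩ := hG.even_of_compl_cycleGraph hn hcont
    rw [← two_mul] at hn hcont
    exact ((hasRigidFiber_compl_cycleGraph (by omega)).of_isIndContained hcont).not_isQuadratic K h
  · rintro ⟨l, hl, hcont⟩
    exact ((hasRigidFiber_prismGraph hl).of_isIndContained hcont).not_isQuadratic K h

end StableSetRing

theorem theorem1p4 (hER : StableSetRing.EverettReedConjecture.{u})
    (K : Type v) [Field K] :
    StableSetRing.OhsugiShibataTsuchiyaConjecture.{u, v} K := by
  intro V _ G hG
  tfae_have 1 ↔ 2 := hER V G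
  tfae_have 2 → 3 := fun h =>
    StableSetRing.isQuadratic_of_kempeEquiv K fun _ _ c d => h.kempeEquiv_blowup hER c d
  tfae_have 3 → 2 := hG.isForbiddenFree_of_isQuadratic
  tfae_finish
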